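/- **Theorem (Strictification Theorem).** Every bicategory \(\mathcal{B}\) is biequivalent to a strict 2-category. That is, for every bicategory \(\mathcal{B}\) there exist a strict 2-category \(\mathcal{B}^{\mathrm{str}}\) (a bicategory in which composition of 1-morphisms is strictly associative and unital and whose associators and unitors are the identity 2-morphisms) and pseudofunctors \[ F:\mathcal{B}\longrightarrow\mathcal{B}^{\mathrm{str}},\qquad G:\mathcal{B}^{\mathrm{str}}\longrightarrow\mathcal{B}, \] together with pseudonatural equivalences \[ G\circ F\simeq \operatorname{Id}_{\mathcal{B}}\qquad\text{and}\qquad F\circ G\simeq \operatorname{Id}_{\mathcal{B}^{\mathrm{str}}}. \] Here a pseudonatural equivalence between pseudofunctors \(H,K:\mathcal{C}\to\mathcal{D}\) is an adjoint equivalence between \(H\) and \(K\) in the bicategory of pseudofunctors \(\mathcal{C}\to\mathcal{D}\), pseudonatural transformations and modifications: pseudonatural transformations \(\sigma:H\Rightarrow K\) and \(\tau:K\Rightarrow H\) with invertible modifications \(\operatorname{id}_H\cong\tau\circ\sigma\) and \(\sigma\circ\tau\cong\operatorname{id}_K\) satisfying the triangle identities. -/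

import Mathlib

open CategoryTheory

-- Makes available the bicategory whose objects are the pseudofunctors between two bicategories,
-- whose 1-morphisms are the pseudonatural transformations (invertible naturality 2-cells) and whose
-- 2-morphisms are the modifications. An internal equivalence there is a pseudonatural equivalence.
open scoped CategoryTheory.Pseudofunctor.StrongTrans

universe w v u

namespace CategoryTheory.Bicategory

/-! Let paths of 1-morphisms be the 1-morphisms of the strictification: concatenation is associative
and unital on the nose. Its 2-morphisms are those of `B` between evaluated paths, so evaluation is
bijective on 2-morphisms and the axioms are pulled back from `B` along `evComp`. The associators and
unitors are then transports along equalities of paths, by induction on the last path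
(`evalComp_nil_left`, `evalComp_assoc`).

Each round trip fixes objects and replaces every 1-morphism by an isomorphic one; it equals some
`conjId m e`, which `conjIdEquivalence` compares with the identity through identity 1-morphisms. -/

lemma pseudofunctor_ext {B : Type*} [Bicategory B] {C : Type*} [Bicategory C]
    {F G : Pseudofunctor B C} (h : F.toPrefunctor = G.toPrefunctor)
    (h₂ : ∀ {a b : B} {f g : a ⟶ b} (η : f ⟶ g), F.map₂ η ≍ G.map₂ η)
    (hId : ∀ a : B, F.mapId a ≍ G.mapId a)
    (hComp : ∀ {a b c : B} (f : a ⟶ b) (g : b ⟶ c), F.mapComp f g ≍ G.mapComp f g) : F = G := by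
  obtain ⟨⟨⟨F, F₂⟩, _, _⟩, FId, FComp, _, _, _, _, _⟩ := F
  obtain ⟨⟨⟨G, G₂⟩, _, _⟩, GId, GComp, _, _, _, _, _⟩ := G
  obtain rfl : F = G := h
  obtain rfl : @F₂ = @G₂ := by
    funext a b f g η
    exact eq_of_heq (h₂ η)
  obtain rfl : FId = GId := funext fun a ↦ eq_of_heq (hId a)
  obtain rfl : @FComp = @GComp := by
    funext a b c f g
    exact eq_of_heq (hComp f g)
  rfl

/-! ### Whiskering identities -/

section

variable {B : Type u} [Bicategory.{w, v} B] {a b c : B}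

lemma whiskerRight_of_iso {f g : a ⟶ b} (η : f ⟶ g) {h h' : b ⟶ c} (e : h ≅ h') :
    η ▷ h = f ◁ e.hom ≫ η ▷ h' ≫ g ◁ e.inv := by
  rw [whisker_exchange_assoc]
  simp

lemma whiskerLeft_of_iso {f f' : a ⟶ b} (e : f ≅ f') {g h : b ⟶ c} (η : g ⟶ h) :
    f ◁ η = e.hom ▷ g ≫ f' ◁ η ≫ e.inv ▷ h := by
  rw [← whisker_exchange_assoc]
  simp

/-- Whisker `h` with `f` and apply the pentagon. This is the inductive step of `evalComp_assoc`,
with the evaluated paths replaced by arbitrary 1-morphisms. -/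
lemma whiskerRight_associator_step {d e : B} {p : a ⟶ b} {q : b ⟶ c} {r : c ⟶ d} (f : d ⟶ e)
    {pq : a ⟶ c} {qr : b ⟶ d} {s t : a ⟶ d} {φ : s ⟶ pq ≫ r} {ψ : pq ⟶ p ≫ q} {θ : s ⟶ t}
    {χ : t ⟶ p ≫ qr} {ω : qr ⟶ q ≫ r}
    (h : φ ≫ ψ ▷ r ≫ (α_ p q r).hom = θ ≫ χ ≫ p ◁ ω) :
    (φ ▷ f ≫ (α_ pq r f).hom) ≫ ψ ▷ (r ≫ f) ≫ (α_ p q (r ≫ f)).hom =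
      θ ▷ f ≫ (χ ▷ f ≫ (α_ p qr f).hom) ≫ p ◁ (ω ▷ f ≫ (α_ q r f).hom) := by
  have h' := congrArg (· ▷ f) h
  simp only [comp_whiskerRight] at h'
  simp only [whiskerRight_comp, Category.assoc, Iso.hom_inv_id_assoc]
  rw [← pentagon, reassoc_of% h']
  simp

end

/-- The strictification of a bicategory: the same objects, formal composites as 1-morphisms, and
2-morphisms between the composites evaluated in the original bicategory. -/
structure Strictification (B : Type u) : Type u where
  /-- The underlying object of the original bicategory. -/
  as : B

/-! ### The bicategory of formal composites -/

namespace Strictification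

variable {B : Type u} [Bicategory.{w, v} B]

/-- The composite in a bicategory of a path of 1-morphisms, bracketed to the left. -/
def eval {a : B} : ∀ {b : B}, Quiver.Path a b → (a ⟶ b)
  | _, .nil => 𝟙 a
  | _, .cons p f => eval p ≫ f

/-- Evaluation of paths is compatible with composition up to isomorphism. -/
def evalComp {a b : B} (p : Quiver.Path a b) :
    ∀ {c : B} (q : Quiver.Path b c), eval (p.comp q) ≅ eval p ≫ eval q
  | _, .nil => (ρ_ (eval p)).symm
  | _, .cons q f => whiskerRightIso (evalComp p q) f ≪≫ α_ (eval p) (eval q) f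

instance : CategoryStruct (Strictification B) where
  Hom a b := Quiver.Path a.as b.as
  id a := (Quiver.Path.nil : Quiver.Path a.as a.as)
  comp p q := Quiver.Path.comp p q

/-- The composite in `B` of a 1-morphism of the strictification. -/
def ev {a b : Strictification B} (p : a ⟶ b) : a.as ⟶ b.as := eval p

/-- A 2-morphism of the strictification is a 2-morphism between the evaluated composites. -/
@[ext]
structure Hom₂ {a b : Strictification B} (p q : a ⟶ b) where
  /-- The underlying 2-morphism. -/
  hom : ev p ⟶ ev q

instance (a b : Strictification B) : Category (a ⟶ b) where
  Hom p q := Hom₂ p q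
  id p := ⟨𝟙 (ev p)⟩
  comp η θ := ⟨η.hom ≫ θ.hom⟩
  id_comp _ := Hom₂.ext (Category.id_comp _)
  comp_id _ := Hom₂.ext (Category.comp_id _)
  assoc _ _ _ := Hom₂.ext (Category.assoc _ _ _)

/-- Compatibility of `ev` with composition. -/
def evComp {a b c : Strictification B} (p : a ⟶ b) (q : b ⟶ c) :
    ev (p ≫ q) ≅ ev p ≫ ev q := evalComp p q

/-- Compatibility of `ev` with identities. -/
def evId (a : Strictification B) : ev (𝟙 a) ≅ 𝟙 a.as := Iso.refl _

/-- The 2-morphism of `B` underlying one of the strictification. -/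
def ev₂ {a b : Strictification B} {p q : a ⟶ b} (η : p ⟶ q) : ev p ⟶ ev q := Hom₂.hom η

/-- The 2-morphism of the strictification given by one of `B`. -/
def mk₂ {a b : Strictification B} {p q : a ⟶ b} (η : ev p ⟶ ev q) : p ⟶ q := Hom₂.mk η

@[simp] lemma ev₂_mk₂ {a b : Strictification B} {p q : a ⟶ b} (η : ev p ⟶ ev q) :
    ev₂ (mk₂ η) = η := rfl

@[simp] lemma ev₂_id {a b : Strictification B} (p : a ⟶ b) : ev₂ (𝟙 p) = 𝟙 (ev p) := rfl

@[simp] lemma ev₂_comp {a b : Strictification B} {p q r : a ⟶ b} (η : p ⟶ q) (θ : q ⟶ r) :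
    ev₂ (η ≫ θ) = ev₂ η ≫ ev₂ θ := rfl

@[ext] lemma ext₂ {a b : Strictification B} {p q : a ⟶ b} {η θ : p ⟶ q} (h : ev₂ η = ev₂ θ) :
    η = θ := Hom₂.ext h

/-- The 2-isomorphism of the strictification given by one of `B`. -/
@[simps]
def isoMk {a b : Strictification B} {p q : a ⟶ b} (e : ev p ≅ ev q) : p ≅ q where
  hom := mk₂ e.hom
  inv := mk₂ e.inv

lemma whiskerRight_ev_comp {a b c : Strictification B} (p : a ⟶ b) (q : b ⟶ c) {x : B}
    {f g : x ⟶ a.as} (η : f ⟶ g) :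
    η ▷ ev (p ≫ q) = f ◁ (evComp p q).hom ≫ (α_ _ _ _).inv ≫ η ▷ ev p ▷ ev q ≫
      (α_ _ _ _).hom ≫ g ◁ (evComp p q).inv := by
  rw [whiskerRight_of_iso η (evComp p q), whiskerRight_comp]
  simp

lemma ev_comp_whiskerLeft {a b c : Strictification B} (p : a ⟶ b) (q : b ⟶ c) {x : B}
    {f g : c.as ⟶ x} (η : f ⟶ g) :
    ev (p ≫ q) ◁ η = (evComp p q).hom ▷ f ≫ (α_ _ _ _).hom ≫ ev p ◁ ev q ◁ η ≫
      (α_ _ _ _).inv ≫ (evComp p q).inv ▷ g := by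
  rw [whiskerLeft_of_iso (evComp p q) η, comp_whiskerLeft]
  simp

lemma whiskerRight_ev_id (a : Strictification B) {x : B} {f g : x ⟶ a.as} (η : f ⟶ g) :
    η ▷ ev (𝟙 a) = f ◁ (evId a).hom ≫ (ρ_ f).hom ≫ η ≫ (ρ_ g).inv ≫ g ◁ (evId a).inv := by
  rw [whiskerRight_of_iso η (evId a), whiskerRight_id]
  simp

lemma ev_id_whiskerLeft (a : Strictification B) {x : B} {f g : a.as ⟶ x} (η : f ⟶ g) :
    ev (𝟙 a) ◁ η = (evId a).hom ▷ f ≫ (λ_ f).hom ≫ η ≫ (λ_ g).inv ≫ (evId a).inv ▷ g := by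
  rw [whiskerLeft_of_iso (evId a) η, id_whiskerLeft]
  simp

instance : Bicategory (Strictification B) where
  whiskerLeft p q r η := mk₂ ((evComp p q).hom ≫ ev p ◁ ev₂ η ≫ (evComp p r).inv)
  whiskerRight {_ _ _ p q} η r := mk₂ ((evComp p r).hom ≫ ev₂ η ▷ ev r ≫ (evComp q r).inv)
  associator p q r := isoMk (evComp (p ≫ q) r ≪≫ whiskerRightIso (evComp p q) (ev r) ≪≫
    α_ (ev p) (ev q) (ev r) ≪≫ whiskerLeftIso (ev p) (evComp q r).symm ≪≫ (evComp p (q ≫ r)).symm)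
  leftUnitor p := isoMk (evComp (𝟙 _) p ≪≫ whiskerRightIso (evId _) (ev p) ≪≫ λ_ (ev p))
  rightUnitor p := isoMk (evComp p (𝟙 _) ≪≫ whiskerLeftIso (ev p) (evId _) ≪≫ ρ_ (ev p))
  whiskerLeft_id _ _ := by ext; simp
  whiskerLeft_comp _ _ _ _ _ _ := by ext; simp
  id_whiskerLeft _ := by ext; simp [ev_id_whiskerLeft]
  comp_whiskerLeft _ _ _ _ _ := by ext; simp [ev_comp_whiskerLeft]
  id_whiskerRight _ _ := by ext; simp
  comp_whiskerRight _ _ _ := by ext; simp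
  whiskerRight_id _ := by ext; simp [whiskerRight_ev_id]
  whiskerRight_comp _ _ _ := by ext; simp [whiskerRight_ev_comp]
  whisker_assoc _ _ _ _ _ := by ext; simp
  whisker_exchange _ _ := by ext; simp [whisker_exchange_assoc]
  -- Expanding the whiskering by `ev (r ≫ s)` exposes `ev (p ≫ q) ◁ (evComp r s).hom`, which cancels
  -- its inverse from `α_ (p ≫ q) r s`.
  pentagon p q r s := by ext; simp [whiskerRight_ev_comp r s]
  triangle _ _ := by ext; simp

/-! ### Strictness -/

/-- The 2-morphism between composites induced by an equality of paths. -/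
def evalEq {a b : B} {p q : Quiver.Path a b} (h : p = q) : eval p ⟶ eval q :=
  eqToHom (congrArg eval h)

lemma evalEq_cons {a b c : B} {p q : Quiver.Path a b} (h : p = q) (f : b ⟶ c)
    (h' : p.cons f = q.cons f) : evalEq h' = (evalEq h ▷ f : eval p ≫ f ⟶ eval q ≫ f) := by
  subst h
  exact (id_whiskerRight _ _).symm

lemma ev₂_eqToHom {a b : Strictification B} {p q : a ⟶ b} (h : p = q) :
    ev₂ (eqToHom h) = evalEq h := by
  subst h
  rfl

/-- Evaluation brackets to the left, so `nil.comp p = p` needs induction on `p`; each step is the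
compatibility of `λ_` with the associator. -/
lemma evalComp_nil_left {a : B} : ∀ {b : B} (p : Quiver.Path a b),
    (evalComp .nil p).hom ≫ (λ_ (eval p)).hom = evalEq p.nil_comp
  | _, .nil => by
    change (ρ_ (𝟙 a)).inv ≫ (λ_ (𝟙 a)).hom = 𝟙 (𝟙 a)
    simp [unitors_equal]
  | _, .cons p f => by
    refine Eq.trans ?_ (evalEq_cons p.nil_comp f _).symm
    rw [← evalComp_nil_left p]
    have key (η : eval (Quiver.Path.nil.comp p) ⟶ 𝟙 a ≫ eval p) :
        (η ▷ f ≫ (α_ (𝟙 a) (eval p) f).hom) ≫ (λ_ (eval p ≫ f)).hom =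
          (η ≫ (λ_ (eval p)).hom) ▷ f := by simp
    exact key _

lemma evalComp_assoc {a b c : B} (p : Quiver.Path a b) (q : Quiver.Path b c) :
    ∀ {d : B} (r : Quiver.Path c d),
      (evalComp (p.comp q) r).hom ≫ (evalComp p q).hom ▷ eval r ≫ (α_ _ _ _).hom =
        evalEq (p.comp_assoc q r) ≫ (evalComp p (q.comp r)).hom ≫ eval p ◁ (evalComp q r).hom
  | _, .nil => by
    change (ρ_ (eval (p.comp q))).inv ≫ (evalComp p q).hom ▷ 𝟙 c ≫ (α_ _ _ (𝟙 c)).hom =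
      𝟙 (eval (p.comp q)) ≫ (evalComp p q).hom ≫ eval p ◁ (ρ_ (eval q)).inv
    simp
  | _, .cons r f => by
    refine Eq.trans ?_ (congrArg (· ≫ _) (evalEq_cons (p.comp_assoc q r) f _).symm)
    exact whiskerRight_associator_step f (evalComp_assoc p q r)

instance : Bicategory.Strict (Strictification B) where
  id_comp p := Quiver.Path.nil_comp p
  comp_id p := Quiver.Path.comp_nil p
  assoc p q r := Quiver.Path.comp_assoc p q r
  leftUnitor_eqToIso {a b} p := by
    ext
    rw [eqToIso.hom, ev₂_eqToHom]
    refine Eq.trans ?_ (evalComp_nil_left p)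
    exact congrArg ((evalComp .nil p).hom ≫ ·)
      (show 𝟙 (𝟙 a.as) ▷ eval p ≫ (λ_ (eval p)).hom = (λ_ (eval p)).hom by simp)
  rightUnitor_eqToIso {a b} p := by
    ext
    rw [eqToIso.hom, ev₂_eqToHom]
    -- Appending `nil` is definitionally trivial, so the transport is an identity.
    change (ρ_ (eval p)).inv ≫ eval p ◁ 𝟙 (𝟙 b.as) ≫ (ρ_ (eval p)).hom = 𝟙 (eval p)
    simp
  associator_eqToIso p q r := by
    ext
    rw [eqToIso.hom, ev₂_eqToHom]
    change (evalComp (Quiver.Path.comp p q) r).hom ≫ (evalComp p q).hom ▷ eval r ≫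
      (α_ (eval p) (eval q) (eval r)).hom ≫ eval p ◁ (evalComp q r).inv ≫
        (evalComp p (Quiver.Path.comp q r)).inv = _
    simp [reassoc_of% evalComp_assoc]

@[simp] lemma ev₂_whiskerLeft {a b c : Strictification B} (p : a ⟶ b) {q r : b ⟶ c} (η : q ⟶ r) :
    ev₂ (p ◁ η) = (evComp p q).hom ≫ ev p ◁ ev₂ η ≫ (evComp p r).inv := rfl

@[simp] lemma ev₂_whiskerRight {a b c : Strictification B} {p q : a ⟶ b} (η : p ⟶ q) (r : b ⟶ c) :
    ev₂ (η ▷ r) = (evComp p r).hom ≫ ev₂ η ▷ ev r ≫ (evComp q r).inv := rfl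

@[simp] lemma ev₂_associator_hom {a b c d : Strictification B} (p : a ⟶ b) (q : b ⟶ c)
    (r : c ⟶ d) :
    ev₂ (α_ p q r).hom = (evComp (p ≫ q) r).hom ≫ (evComp p q).hom ▷ ev r ≫
      (α_ (ev p) (ev q) (ev r)).hom ≫ ev p ◁ (evComp q r).inv ≫ (evComp p (q ≫ r)).inv := rfl

@[simp] lemma ev₂_leftUnitor_hom {a b : Strictification B} (p : a ⟶ b) :
    ev₂ (λ_ p).hom = (evComp (𝟙 a) p).hom ≫ (evId a).hom ▷ ev p ≫ (λ_ (ev p)).hom := rfl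

@[simp] lemma ev₂_rightUnitor_hom {a b : Strictification B} (p : a ⟶ b) :
    ev₂ (ρ_ p).hom = (evComp p (𝟙 b)).hom ≫ ev p ◁ (evId b).hom ≫ (ρ_ (ev p)).hom := rfl

/-! ### The two pseudofunctors -/

variable (B) in
/-- Evaluation of formal composites, as a pseudofunctor. -/
def evalPseudofunctor : Pseudofunctor (Strictification B) B where
  obj a := a.as
  map p := ev p
  map₂ η := ev₂ η
  mapId a := evId a
  mapComp p q := evComp p q

/-- A 1-morphism, as a formal composite of length one. -/
def single {a b : B} (f : a ⟶ b) : (⟨a⟩ : Strictification B) ⟶ ⟨b⟩ :=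
  Quiver.Path.cons Quiver.Path.nil f

/-- Evaluating a formal composite of length one. -/
def evSingle {a b : B} (f : a ⟶ b) : ev (single f) ≅ f := λ_ f

variable (B) in
/-- The inclusion of a bicategory in its strictification. -/
def inclusion : Pseudofunctor B (Strictification B) where
  obj a := ⟨a⟩
  map f := single f
  map₂ {a b f g} η := mk₂ ((evSingle f).hom ≫ η ≫ (evSingle g).inv)
  mapId a := isoMk (evSingle (𝟙 a) ≪≫ (evId ⟨a⟩).symm)
  mapComp f g := isoMk (evSingle (f ≫ g) ≪≫ whiskerRightIso (evSingle f).symm g ≪≫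
    whiskerLeftIso (ev (single f)) (evSingle g).symm ≪≫ (evComp (single f) (single g)).symm)
  map₂_id _ := by ext; simp
  map₂_comp _ _ := by ext; simp
  map₂_whisker_left _ _ _ _ := by ext; simp [whisker_exchange_assoc]
  map₂_whisker_right _ _ := by ext; simp [whisker_exchange_assoc]
  map₂_associator _ _ _ := by
    ext
    simp [whisker_exchange_assoc]
    rw [associator_inv_naturality_right_assoc, whisker_exchange_assoc]
    simp
  map₂_left_unitor _ := by ext; simp [whisker_exchange_assoc]
  map₂_right_unitor _ := by ext; simp

end Strictification

/-! ### Pseudofunctors isomorphic to the identity -/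

variable {B : Type u} [Bicategory.{w, v} B]

/-- The pseudofunctor isomorphic to the identity obtained by replacing each 1-morphism by an
isomorphic one. -/
def conjId (m : ∀ {a b : B}, (a ⟶ b) → (a ⟶ b)) (e : ∀ {a b : B} (f : a ⟶ b), m f ≅ f) :
    Pseudofunctor B B where
  obj a := a
  map f := m f
  map₂ {_ _ f g} η := (e f).hom ≫ η ≫ (e g).inv
  mapId a := e (𝟙 a)
  mapComp f g := e (f ≫ g) ≪≫ whiskerRightIso (e f).symm g ≪≫ whiskerLeftIso (m f) (e g).symm
  map₂_whisker_left _ _ _ _ := by simp [whisker_exchange_assoc]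
  map₂_whisker_right _ _ := by simp [whisker_exchange_assoc]
  map₂_associator _ _ _ := by
    simp [whisker_exchange_assoc]
    rw [associator_inv_naturality_right_assoc, whisker_exchange_assoc]
    simp
  map₂_left_unitor _ := by simp [whisker_exchange_assoc]
  map₂_right_unitor _ := by simp

/-- The identity-on-objects transformation from the conjugated identity. -/
def conjIdHom (m : ∀ {a b : B}, (a ⟶ b) → (a ⟶ b)) (e : ∀ {a b : B} (f : a ⟶ b), m f ≅ f) :
    conjId m e ⟶ Pseudofunctor.id B where
  app a := 𝟙 a
  naturality f := ρ_ (m f) ≪≫ e f ≪≫ (λ_ f).symm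
  naturality_naturality {a b f g} η := by
    change ((e f).hom ≫ η ≫ (e g).inv) ▷ 𝟙 b ≫ (ρ_ (m g)).hom ≫ (e g).hom ≫ (λ_ g).inv =
      ((ρ_ (m f)).hom ≫ (e f).hom ≫ (λ_ f).inv) ≫ 𝟙 a ◁ η
    simp
  naturality_id a := by
    change ((ρ_ (m (𝟙 a))).hom ≫ (e (𝟙 a)).hom ≫ (λ_ (𝟙 a)).inv) ≫ 𝟙 a ◁ 𝟙 (𝟙 a) =
      (e (𝟙 a)).hom ▷ 𝟙 a ≫ (λ_ (𝟙 a)).hom ≫ (ρ_ (𝟙 a)).inv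
    simp [unitors_equal, unitors_inv_equal]
  naturality_comp {a b c} f g := by
    change ((ρ_ (m (f ≫ g))).hom ≫ (e (f ≫ g)).hom ≫ (λ_ (f ≫ g)).inv) ≫ 𝟙 a ◁ 𝟙 (f ≫ g) =
      ((e (f ≫ g)).hom ≫ (e f).inv ▷ g ≫ m f ◁ (e g).inv) ▷ 𝟙 c ≫ (α_ (m f) (m g) (𝟙 c)).hom ≫
        m f ◁ ((ρ_ (m g)).hom ≫ (e g).hom ≫ (λ_ g).inv) ≫ (α_ (m f) (𝟙 b) g).inv ≫
          ((ρ_ (m f)).hom ≫ (e f).hom ≫ (λ_ f).inv) ▷ g ≫ (α_ (𝟙 a) f g).hom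
    simp

/-- The identity-on-objects transformation to the conjugated identity. -/
def conjIdInv (m : ∀ {a b : B}, (a ⟶ b) → (a ⟶ b)) (e : ∀ {a b : B} (f : a ⟶ b), m f ≅ f) :
    Pseudofunctor.id B ⟶ conjId m e where
  app a := 𝟙 a
  naturality f := ρ_ f ≪≫ (e f).symm ≪≫ (λ_ (m f)).symm
  naturality_naturality {a b f g} η := by
    change η ▷ 𝟙 b ≫ (ρ_ g).hom ≫ (e g).inv ≫ (λ_ (m g)).inv =
      ((ρ_ f).hom ≫ (e f).inv ≫ (λ_ (m f)).inv) ≫ 𝟙 a ◁ ((e f).hom ≫ η ≫ (e g).inv)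
    simp
  naturality_id a := by
    change ((ρ_ (𝟙 a)).hom ≫ (e (𝟙 a)).inv ≫ (λ_ (m (𝟙 a))).inv) ≫ 𝟙 a ◁ (e (𝟙 a)).hom =
      𝟙 (𝟙 a) ▷ 𝟙 a ≫ (λ_ (𝟙 a)).hom ≫ (ρ_ (𝟙 a)).inv
    simp [unitors_equal, unitors_inv_equal]
  naturality_comp {a b c} f g := by
    change ((ρ_ (f ≫ g)).hom ≫ (e (f ≫ g)).inv ≫ (λ_ (m (f ≫ g))).inv) ≫
        𝟙 a ◁ ((e (f ≫ g)).hom ≫ (e f).inv ▷ g ≫ m f ◁ (e g).inv) =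
      𝟙 (f ≫ g) ▷ 𝟙 c ≫ (α_ f g (𝟙 c)).hom ≫
        f ◁ ((ρ_ g).hom ≫ (e g).inv ≫ (λ_ (m g)).inv) ≫ (α_ f (𝟙 b) (m g)).inv ≫
          ((ρ_ f).hom ≫ (e f).inv ≫ (λ_ (m f)).inv) ▷ m g ≫ (α_ (𝟙 a) (m f) (m g)).hom
    simp [whisker_exchange]

/-- The conjugated identity is equivalent to the identity. -/
def conjIdEquivalence (m : ∀ {a b : B}, (a ⟶ b) → (a ⟶ b))
    (e : ∀ {a b : B} (f : a ⟶ b), m f ≅ f) :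
    Bicategory.Equivalence (conjId m e) (Pseudofunctor.id B) :=
  -- Two invertible modifications suffice: modifying the counit yields the triangle identities.
  .mkOfAdjointifyCounit (f := conjIdHom m e) (g := conjIdInv m e)
    (Pseudofunctor.StrongTrans.isoMk (fun a ↦ (λ_ (𝟙 a)).symm) (by
      intro a b f
      change m f ◁ (λ_ (𝟙 b)).inv ≫ (α_ (m f) (𝟙 b) (𝟙 b)).inv ≫
          ((ρ_ (m f)).hom ≫ (e f).hom ≫ (λ_ f).inv) ▷ 𝟙 b ≫ (α_ (𝟙 a) f (𝟙 b)).hom ≫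
            𝟙 a ◁ ((ρ_ f).hom ≫ (e f).inv ≫ (λ_ (m f)).inv) ≫ (α_ (𝟙 a) (𝟙 a) (m f)).inv =
        ((ρ_ (m f)).hom ≫ (λ_ (m f)).inv) ≫ (λ_ (𝟙 a)).inv ▷ m f
      simp [-unitors_inv_equal]))
    (Pseudofunctor.StrongTrans.isoMk (fun a ↦ λ_ (𝟙 a)) (by
      intro a b f
      change f ◁ (λ_ (𝟙 b)).hom ≫ (ρ_ f).hom ≫ (λ_ f).inv =
        ((α_ f (𝟙 b) (𝟙 b)).inv ≫ ((ρ_ f).hom ≫ (e f).inv ≫ (λ_ (m f)).inv) ▷ 𝟙 b ≫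
          (α_ (𝟙 a) (m f) (𝟙 b)).hom ≫ 𝟙 a ◁ ((ρ_ (m f)).hom ≫ (e f).hom ≫ (λ_ f).inv) ≫
            (α_ (𝟙 a) (𝟙 a) f).inv) ≫ (λ_ (𝟙 a)).hom ▷ f
      simp [unitors_equal]))

/-! ### The two round trips -/

namespace Strictification

variable (B) in
lemma inclusion_comp_evalPseudofunctor :
    (inclusion B).comp (evalPseudofunctor B) =
      conjId (fun f ↦ ev (single f)) (fun f ↦ evSingle f) := by
  -- Objects, 1-morphisms and 2-morphisms agree definitionally; only the comparison cells remain.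
  refine pseudofunctor_ext rfl (fun _ ↦ HEq.rfl) (fun a ↦ heq_of_eq (Iso.ext ?_))
    (fun f g ↦ heq_of_eq (Iso.ext ?_))
  · change ((evSingle (𝟙 a)).hom ≫ (evId ⟨a⟩).inv) ≫ (evId ⟨a⟩).hom = (evSingle (𝟙 a)).hom
    simp
  · change ((evSingle (f ≫ g)).hom ≫ (evSingle f).inv ▷ g ≫ ev (single f) ◁ (evSingle g).inv ≫
      (evComp (single f) (single g)).inv) ≫ (evComp (single f) (single g)).hom =
        (evSingle (f ≫ g)).hom ≫ (evSingle f).inv ▷ g ≫ ev (single f) ◁ (evSingle g).inv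
    simp

variable (B) in
lemma evalPseudofunctor_comp_inclusion :
    (evalPseudofunctor B).comp (inclusion B) =
      conjId (fun f ↦ single (ev f)) (fun f ↦ isoMk (evSingle (ev f))) := by
  refine pseudofunctor_ext rfl (fun _ ↦ HEq.rfl) (fun a ↦ heq_of_eq (Iso.ext (ext₂ ?_)))
    (fun p q ↦ heq_of_eq (Iso.ext (ext₂ ?_)))
  · change ((evSingle (ev (𝟙 a))).hom ≫ (evId a).hom ≫ (evSingle (𝟙 a.as)).inv) ≫
      (evSingle (𝟙 a.as)).hom ≫ (evId a).inv = (evSingle (ev (𝟙 a))).hom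
    simp
  · change ((evSingle (ev (p ≫ q))).hom ≫ (evComp p q).hom ≫ (evSingle (ev p ≫ ev q)).inv) ≫
      (evSingle (ev p ≫ ev q)).hom ≫ (evSingle (ev p)).inv ▷ ev q ≫
        ev (single (ev p)) ◁ (evSingle (ev q)).inv ≫
          (evComp (single (ev p)) (single (ev q))).inv =
      (evSingle (ev (p ≫ q))).hom ≫
        ((evComp p q).hom ≫ (evSingle (ev p)).inv ▷ ev q ≫ (evComp (single (ev p)) q).inv) ≫
          (evComp (single (ev p)) q).hom ≫ ev (single (ev p)) ◁ (evSingle (ev q)).inv ≫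
            (evComp (single (ev p)) (single (ev q))).inv
    simp

end Strictification

end CategoryTheory.Bicategory

theorem mainTheorem1 (B : Type u) [Bicategory.{w, v} B] :
    ∃ (Bstr : Type u) (_ : Bicategory.{w, max u v} Bstr),
      Bicategory.Strict Bstr ∧
      ∃ (F : Pseudofunctor B Bstr) (G : Pseudofunctor Bstr B),
        Nonempty (Bicategory.Equivalence (F.comp G) (Pseudofunctor.id B)) ∧
        Nonempty (Bicategory.Equivalence (G.comp F) (Pseudofunctor.id Bstr)) := by
  refine ⟨Bicategory.Strictification B, inferInstance, inferInstance,
    Bicategory.Strictification.inclusion B, Bicategory.Strictification.evalPseudofunctor B, ?_, ?_⟩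
  · rw [Bicategory.Strictification.inclusion_comp_evalPseudofunctor]
    exact ⟨Bicategory.conjIdEquivalence _ _⟩
  · rw [Bicategory.Strictification.evalPseudofunctor_comp_inclusion]
    exact ⟨Bicategory.conjIdEquivalence _ _⟩
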